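/- Let $G$ be a finite connected graph (multiple edges and loops are allowed; a loop counts twice in the degree of its vertex) with vertex set $V$ and edge set $E$, and fix an orientation of its edges. For a commutative ring $R$ let $H^1(G,R)$ be the cokernel of the coboundary map $d\colon R^V\to R^E$, $(df)(e)=f(\mathrm{end}(e))-f(\mathrm{beg}(e))$. For an edge $e$ let $e^*\in H^1(G,\mathbb Z)$ be the class of the indicator function of $e$; these classes are called coedges. A strong $\mathbb Q$-emm (strong edge-minimizing metric) of $G$ is a positive definite quadratic form $q$ on the rational vector space $H^1(G,\mathbb Q)$ such that 1. $q(e^*)=1$ for every edge $e$ that is not a bridge; 2. $q(v^*)\ge 1$ for every nonzero $v^*\in H^1(G,\mathbb Z)$; 3. if $q(v^*)=1$ for some $v^*\in H^1(G,\mathbb Z)$, then $v^*$ or $-v^*$ is a coedge. (Here $q$ is evaluated on $H^1(G,\mathbb Z)$ through the natural map $H^1(G,\mathbb Z)\to H^1(G,\mathbb Q)$.) Theorem. Every finite connected bridgeless cubic graph (all vertices have degree $3$, no edge is a bridge) admits a strong $\mathbb Q$-emm, for every orientation of its edges. -/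

import Mathlib

namespace Graph

universe u v w

/-- The degree of a vertex: the number of edge ends at it, so that a loop counts twice. -/
noncomputable def degree {α : Type u} {β : Type v} (G : Graph α β) (x : α) : ℕ :=
  (G.incidenceSet x).ncard + (G.loopSet x).ncard

/-- A graph is cubic (trivalent) if all its vertices have degree `3`. -/
def Cubic {α : Type u} {β : Type v} (G : Graph α β) : Prop :=
  ∀ x ∈ G.vertexSet, G.degree x = 3

/-- `G.Reachable x y`: there is a (possibly empty) path of edges of `G` from `x` to `y`. -/
def Reachable {α : Type u} {β : Type v} (G : Graph α β) (x y : α) : Prop :=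
  Relation.ReflTransGen G.Adj x y

/-- A graph is connected if it is non-empty and any two of its vertices are joined by a path. -/
def Connected {α : Type u} {β : Type v} (G : Graph α β) : Prop :=
  G.vertexSet.Nonempty ∧ ∀ x ∈ G.vertexSet, ∀ y ∈ G.vertexSet, G.Reachable x y

/-- An edge is a bridge if its two ends are no longer joined by a path once it is deleted. -/
def IsBridge {α : Type u} {β : Type v} (G : Graph α β) (e : β) : Prop :=
  ∃ x y, G.IsLink e x y ∧ ¬ (G.deleteEdges {e}).Reachable x y

/-- A graph is bridgeless if none of its edges is a bridge. -/
def Bridgeless {α : Type u} {β : Type v} (G : Graph α β) : Prop :=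
  ∀ e ∈ G.edgeSet, ¬ G.IsBridge e

/-- An orientation of a graph: each edge gets a beginning and an end. -/
structure Orientation {α : Type u} {β : Type v} (G : Graph α β) where
  /-- the beginning of an edge -/
  source : G.edgeSet → G.vertexSet
  /-- the end of an edge -/
  target : G.edgeSet → G.vertexSet
  isLink : ∀ e : G.edgeSet, G.IsLink e (source e) (target e)

namespace Orientation

variable {α : Type u} {β : Type v} {G : Graph α β}

/-- The coboundary map `d : C⁰(G, R) → C¹(G, R)`. The value of `d f` on an edge is the value of `f`
at its end minus the value of `f` at its beginning; thus `d v*` is the sum of the `e*` over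
the edges `e` that end at `v` minus the sum of the `e*` over the edges `e` that begin at `v`. -/
def coboundary (o : G.Orientation) (R : Type w) [CommRing R] :
    (G.vertexSet → R) →ₗ[R] (G.edgeSet → R) where
  toFun f := fun e => f (o.target e) - f (o.source e)
  map_add' f g := by
    funext e
    simp only [Pi.add_apply]
    ring
  map_smul' c f := by
    funext e
    simp only [Pi.smul_apply, smul_eq_mul, RingHom.id_apply]
    ring

/-- The first cohomology group `H¹(G, R)`, the cokernel of the coboundary map. -/
abbrev H1 (o : G.Orientation) (R : Type w) [CommRing R] : Type (max v w) :=
  (G.edgeSet → R) ⧸ LinearMap.range (o.coboundary R)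

/-- The natural map `H¹(G, ℤ) → H¹(G, R)`, induced by `ℤ → R` on cochains. -/
def coeffMap (o : G.Orientation) (R : Type w) [CommRing R] : o.H1 ℤ →ₗ[ℤ] o.H1 R :=
  Submodule.liftQ (LinearMap.range (o.coboundary ℤ))
    ((LinearMap.range (o.coboundary R)).mkQ.toAddMonoidHom.comp
      ((Int.castAddHom R).compLeft G.edgeSet)).toIntLinearMap
    (by
      rintro _ ⟨f, rfl⟩
      rw [LinearMap.mem_ker]
      refine (Submodule.Quotient.mk_eq_zero _).2 ⟨fun x => (f x : R), ?_⟩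
      funext e
      simp [coboundary])

open Classical in
/-- The class `e*` in `H¹(G, ℤ)` of an edge `e`. -/
noncomputable def coedge (o : G.Orientation) (e : G.edgeSet) : o.H1 ℤ :=
  (LinearMap.range (o.coboundary ℤ)).mkQ (Pi.single e 1)

/-- An edge-minimizing metric (`R`-emm) of a graph, for `R = ℤ`, `ℚ` or `ℝ`: an element of
`Sym² H₁(G, R)`, that is, a quadratic form on `H¹(G, R)`, which is positive definite,
equal to `1` on the coedges of all edges that are not bridges, and at least `1`
on all nonzero vectors of `H¹(G, ℤ)`. -/
structure IsEmm (o : G.Orientation) {R : Type w} [CommRing R] [PartialOrder R]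
    (q : QuadraticForm R (o.H1 R)) : Prop where
  posDef : q.PosDef
  coedge_eq : ∀ e : G.edgeSet, ¬ G.IsBridge e → q (o.coeffMap R (o.coedge e)) = 1
  one_le : ∀ v : o.H1 ℤ, v ≠ 0 → 1 ≤ q (o.coeffMap R v)

/-- A strong `R`-emm: the only integral vectors of norm `1` are the coedges and their negatives. -/
structure IsStrongEmm (o : G.Orientation) {R : Type w} [CommRing R] [PartialOrder R]
    (q : QuadraticForm R (o.H1 R)) : Prop extends o.IsEmm q where
  eq_coedge : ∀ v : o.H1 ℤ, q (o.coeffMap R v) = 1 →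
    ∃ e : G.edgeSet, v = o.coedge e ∨ v = -o.coedge e

end Orientation

end Graph

/-! For a rational cycle `y`, take a random integral cycle with mean `y` whose value on each edge
`e` is one of the two integers `l e`, `l e + 1` around `y e`. It exists because the polytope of
cycles in such a box has integral vertices. Its variance is a quadratic form on cohomology. An
integer-valued variable with mean `t` has variance at least `{t}(1 - {t})`, where `{t}` is the
fractional part, with equality if it only takes the two integers around `t`. So the variance is at
least this bound on every integral class and equals it on coedges (`exists_isMoment`). Now sum over
all `N`-torsion points `y` of the torus of cycles. The pairing with a primitive class is
equidistributed modulo `N`, so the bounds add up to a constant `K` independent of the class. Coedges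
of non-bridges are primitive, hence the sum divided by `K` is an emm (`exists_isEmm_of_isMoment`).
For strictness, let `w` be primitive and not proportional to a coedge. Some torsion point pairs
integrally with `w` but has no integral coordinate. There the bound for `w` is `0`, while the random
cycle can be chosen with positive variance along `w`, so `w` becomes longer than `1`
(`exists_isEmm_one_lt`). An emm has finitely many minimal vectors (`IsEmm.finite_minimal`), and
averaging with such emms removes the unwanted ones one at a time. -/

namespace Graph.Orientation

open Finset

/-! ### Cycles and their pairing with cohomology -/

section Cycles

variable {α β : Type*} {G : Graph α β} [Fintype G.edgeSet] (o : G.Orientation)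

/-- The cycles of a graph with coefficients in `R`: the chains orthogonal to all coboundaries. -/
def cycles (R : Type*) [CommRing R] : Submodule R (G.edgeSet → R) where
  carrier := {x | ∀ f, ∑ e, x e * o.coboundary R f e = 0}
  add_mem' {x y} hx hy f := by
    simp only [Pi.add_apply, add_mul, sum_add_distrib]
    rw [hx f, hy f, add_zero]
  zero_mem' f := by simp
  smul_mem' c x hx f := by
    simp only [Pi.smul_apply, smul_eq_mul, mul_assoc, ← mul_sum]
    rw [hx f, mul_zero]

variable {o}

lemma mem_cycles {R : Type*} [CommRing R] {x : G.edgeSet → R} :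
    x ∈ o.cycles R ↔ ∀ f, ∑ e, x e * o.coboundary R f e = 0 := Iff.rfl

/-- The evaluation of cohomology classes on a cycle. -/
def pair {R : Type*} [CommRing R] (x : o.cycles R) : o.H1 R →ₗ[R] R :=
  Submodule.liftQ (LinearMap.range (o.coboundary R)) (Fintype.linearCombination R x.1) (by
    rintro _ ⟨f, rfl⟩
    rw [LinearMap.mem_ker, Fintype.linearCombination_apply]
    rw [← x.2 f]
    exact sum_congr rfl fun e _ => mul_comm _ _)

lemma pair_mkQ {R : Type*} [CommRing R] (x : o.cycles R) (u : G.edgeSet → R) :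
    pair x ((LinearMap.range (o.coboundary R)).mkQ u) = ∑ e, x.1 e * u e := by
  simp only [pair, Submodule.mkQ_apply, Submodule.liftQ_apply, Fintype.linearCombination_apply]
  exact sum_congr rfl fun e _ => mul_comm _ _

lemma pair_add {R : Type*} [CommRing R] (x y : o.cycles R) (v : o.H1 R) :
    pair (x + y) v = pair x v + pair y v := by
  obtain ⟨u, rfl⟩ := Submodule.mkQ_surjective _ v
  simp only [pair_mkQ, ← sum_add_distrib, ← add_mul]
  rfl

lemma pair_smul {R : Type*} [CommRing R] (c : R) (x : o.cycles R) (v : o.H1 R) :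
    pair (c • x) v = c * pair x v := by
  obtain ⟨u, rfl⟩ := Submodule.mkQ_surjective _ v
  simp only [pair_mkQ, mul_sum, ← mul_assoc]
  rfl

lemma pair_sum {R ι : Type*} [CommRing R] (s : Finset ι) (x : ι → o.cycles R) (v : o.H1 R) :
    pair (∑ i ∈ s, x i) v = ∑ i ∈ s, pair (x i) v := by
  classical
  induction s using Finset.induction_on with
  | empty =>
    have := pair_smul (0 : R) (0 : o.cycles R) v
    simpa using this
  | insert i s hi ih => rw [sum_insert hi, sum_insert hi, pair_add, ih]

lemma pair_coedge (x : o.cycles ℤ) (e : G.edgeSet) : pair x (o.coedge e) = x.1 e := by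
  classical
  rw [coedge, pair_mkQ]
  simp [Pi.single_apply]

omit [Fintype G.edgeSet] in
lemma coeffMap_mkQ {R : Type*} [CommRing R] (u : G.edgeSet → ℤ) :
    o.coeffMap R ((LinearMap.range (o.coboundary ℤ)).mkQ u)
      = (LinearMap.range (o.coboundary R)).mkQ fun e => (u e : R) := rfl

lemma pair_coeffMap_coedge {R : Type*} [CommRing R] (x : o.cycles R) (e : G.edgeSet) :
    pair x (o.coeffMap R (o.coedge e)) = x.1 e := by
  classical
  rw [coedge, coeffMap_mkQ, pair_mkQ]
  simp [Pi.single_apply]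

/-- A chain is a cycle if and only if it is conserved at every vertex. -/
lemma mem_cycles_iff_vertex [Finite G.vertexSet] [DecidableEq G.vertexSet]
    {R : Type*} [CommRing R] {x : G.edgeSet → R} :
    x ∈ o.cycles R ↔ ∀ v : G.vertexSet, ∑ e, x e *
      ((if o.target e = v then 1 else 0) - (if o.source e = v then 1 else 0)) = 0 := by
  have := Fintype.ofFinite G.vertexSet
  rw [mem_cycles]
  constructor
  · intro h v
    simpa [coboundary, Pi.single_apply] using h (Pi.single v 1)
  · intro h f
    have h1 : ∀ e, x e * o.coboundary R f e = ∑ v, f v * (x e *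
        ((if o.target e = v then 1 else 0) - (if o.source e = v then 1 else 0))) := by
      intro e
      simp [coboundary, mul_sub, sum_sub_distrib, mul_comm]
    simp_rw [h1]
    rw [sum_comm]
    simp_rw [← mul_sum]
    simp [h]

end Cycles

/-! ### Integral versus rational classes; duality and divisibility -/

section Cast

variable {α β : Type*} {G : Graph α β} [Fintype G.edgeSet] [Finite G.vertexSet] {o : G.Orientation}

/-- An integral cycle, seen as a rational one. -/
def castCycle (x : o.cycles ℤ) : o.cycles ℚ :=
  ⟨fun e => x.1 e, by
    classical
    rw [mem_cycles_iff_vertex]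
    intro v
    have := mem_cycles_iff_vertex.1 x.2 v
    have h := congrArg (Int.cast : ℤ → ℚ) this
    push_cast at h
    exact h⟩

lemma pair_castCycle (x : o.cycles ℤ) (v : o.H1 ℤ) :
    pair (castCycle x) (o.coeffMap ℚ v) = pair x v := by
  obtain ⟨u, rfl⟩ := Submodule.mkQ_surjective _ v
  rw [coeffMap_mkQ, pair_mkQ, pair_mkQ]
  push_cast
  rfl

omit [Finite G.vertexSet] in
lemma exists_nat_mul_eq_intCast (u : G.edgeSet → ℚ) :
    ∃ n : ℕ, 0 < n ∧ ∃ w : G.edgeSet → ℤ, ∀ e, (w e : ℚ) = n * u e := by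
  classical
  refine ⟨∏ e, (u e).den, prod_pos fun e _ => (u e).den_pos,
    fun e => (u e).num * ∏ e' ∈ univ.erase e, ((u e').den : ℤ), fun e => ?_⟩
  rw [← mul_prod_erase univ _ (mem_univ e)]
  push_cast
  nth_rw 3 [← Rat.num_div_den (u e)]
  have : ((u e).den : ℚ) ≠ 0 := by exact_mod_cast (u e).den_nz
  field_simp

lemma exists_nat_smul_eq_castCycle (y : o.cycles ℚ) :
    ∃ n : ℕ, 0 < n ∧ ∃ x : o.cycles ℤ, castCycle x = (n : ℚ) • y := by
  classical
  obtain ⟨n, hn, w, hw⟩ := exists_nat_mul_eq_intCast y.1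
  refine ⟨n, hn, ⟨w, ?_⟩, ?_⟩
  · rw [mem_cycles_iff_vertex]
    intro v
    have h := mem_cycles_iff_vertex.1 ((n : ℚ) • y).2 v
    have : (((∑ e, w e * ((if o.target e = v then 1 else 0) -
        (if o.source e = v then 1 else 0)) : ℤ)) : ℚ) = 0 := by
      push_cast
      refine Eq.trans (sum_congr rfl fun e _ => ?_) h
      rw [hw]
      rfl
    exact_mod_cast this
  · ext e
    exact hw e

omit [Finite G.vertexSet] in
lemma exists_nat_smul_eq_coeffMap (v : o.H1 ℚ) :
    ∃ n : ℕ, 0 < n ∧ ∃ w : o.H1 ℤ, o.coeffMap ℚ w = (n : ℚ) • v := by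
  obtain ⟨u, rfl⟩ := Submodule.mkQ_surjective _ v
  obtain ⟨n, hn, w, hw⟩ := exists_nat_mul_eq_intCast u
  refine ⟨n, hn, (LinearMap.range (o.coboundary ℤ)).mkQ w, ?_⟩
  rw [coeffMap_mkQ, ← map_smul]
  congr 1
  funext e
  exact hw e

-- A cochain that is not a coboundary is separated from the coboundaries by a linear functional, and
-- the coefficients of that functional form a cycle.
omit [Finite G.vertexSet] in
lemma eq_zero_of_pair_eq_zero {v : o.H1 ℚ} (h : ∀ x : o.cycles ℚ, pair x v = 0) : v = 0 := by
  classical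
  obtain ⟨u, rfl⟩ := Submodule.mkQ_surjective _ v
  by_contra hne
  have hu : u ∉ LinearMap.range (o.coboundary ℚ) := fun hu =>
    hne ((Submodule.Quotient.mk_eq_zero _).2 hu)
  obtain ⟨f, hf, hle⟩ := Submodule.exists_le_ker_of_notMem hu
  have hfx : ∀ w : G.edgeSet → ℚ, f w = ∑ e, f (Pi.single e 1) * w e := by
    intro w
    conv_lhs => rw [pi_eq_sum_univ' w]
    simp only [map_sum, map_smul, smul_eq_mul]
    exact sum_congr rfl fun e _ => mul_comm _ _
  refine hf ?_
  rw [hfx, ← h ⟨fun e => f (Pi.single e 1), fun g => ?_⟩, pair_mkQ]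
  rw [← hfx]
  exact hle ⟨g, rfl⟩

-- A rational potential with integral differences along edges can be replaced by its floor without
-- changing these differences.
omit [Fintype G.edgeSet] [Finite G.vertexSet] in
lemma coeffMap_injective : Function.Injective (o.coeffMap ℚ) := by
  rw [injective_iff_map_eq_zero]
  intro v hv
  obtain ⟨u, rfl⟩ := Submodule.mkQ_surjective _ v
  obtain ⟨f, hf⟩ := (Submodule.Quotient.mk_eq_zero _).1 hv
  refine (Submodule.Quotient.mk_eq_zero _).2 ⟨fun x => ⌊f x⌋, ?_⟩
  funext e
  have h : f (o.target e) - f (o.source e) = (u e : ℚ) := congrFun hf e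
  have h' : f (o.target e) = f (o.source e) + (u e : ℤ) := by linarith
  change ⌊f (o.target e)⌋ - ⌊f (o.source e)⌋ = u e
  rw [h', Int.floor_add_intCast]
  ring

lemma eq_zero_of_pair_int_eq_zero {v : o.H1 ℤ} (h : ∀ x : o.cycles ℤ, pair x v = 0) : v = 0 := by
  apply coeffMap_injective
  rw [map_zero]
  refine eq_zero_of_pair_eq_zero fun y => ?_
  obtain ⟨n, hn, x, hx⟩ := exists_nat_smul_eq_castCycle y
  have h1 := pair_castCycle x v
  rw [hx, pair_smul, h x, Int.cast_zero] at h1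
  have : (n : ℚ) ≠ 0 := by positivity
  simpa [this] using h1

/-- The image of the boundary map is free, so the integral cycles are a direct summand of the
chains. The functional `pair · v / c` on cycles therefore extends, through a retraction, to an
integral cochain. -/
lemma exists_smul_eq_of_dvd_pair (c : ℤ) {v : o.H1 ℤ} (h : ∀ x : o.cycles ℤ, c ∣ pair x v) :
    ∃ u : o.H1 ℤ, v = c • u := by
  classical
  let bd : (G.edgeSet → ℤ) →ₗ[ℤ] (G.vertexSet → ℤ) := LinearMap.pi fun v =>
    ∑ e, (((if o.target e = v then 1 else 0) - (if o.source e = v then 1 else 0) : ℤ) •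
      LinearMap.proj (R := ℤ) e)
  have hbd : ∀ x, bd x = 0 ↔ x ∈ o.cycles ℤ := by
    intro x
    rw [mem_cycles_iff_vertex, funext_iff]
    refine forall_congr' fun v => ?_
    simp only [bd, LinearMap.pi_apply, LinearMap.sum_apply, LinearMap.smul_apply,
      LinearMap.proj_apply, smul_eq_mul, Pi.zero_apply]
    simp_rw [mul_comm (x _)]
  obtain ⟨s, hs⟩ := LinearMap.exists_rightInverse_of_surjective bd.rangeRestrict
    (LinearMap.range_rangeRestrict bd)
  have hs' : ∀ x, bd (s (bd.rangeRestrict x)) = bd x := fun x =>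
    congrArg Subtype.val (LinearMap.congr_fun hs (bd.rangeRestrict x))
  -- The retraction onto cycles given by the section `s` of the boundary map.
  let r : (G.edgeSet → ℤ) → o.cycles ℤ := fun x =>
    ⟨x - s (bd.rangeRestrict x), (hbd _).1 (by rw [map_sub, hs', sub_self])⟩
  have hr : ∀ x : o.cycles ℤ, r x.1 = x := by
    intro x
    have : bd.rangeRestrict x.1 = 0 := Subtype.ext ((hbd _).2 x.2)
    ext e
    simp [r, this]
  have hradd : ∀ (x : G.edgeSet → ℤ), r x = ∑ e, x e • r (Pi.single e 1) := by
    intro x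
    have h1 : x = ∑ e, x e • Pi.single e (1 : ℤ) := by
      funext j; simp [Finset.sum_apply, Pi.single_apply]
    apply Subtype.ext
    have : ((∑ e, x e • r (Pi.single e 1) : o.cycles ℤ) : G.edgeSet → ℤ) =
        ∑ e, x e • (Pi.single e (1 : ℤ) - s (bd.rangeRestrict (Pi.single e 1))) := by
      simp [r]
    rw [this]
    simp only [smul_sub, sum_sub_distrib, ← h1, ← map_smul, ← map_sum]
    rfl
  choose k hk using h
  refine ⟨(LinearMap.range (o.coboundary ℤ)).mkQ fun e => k (r (Pi.single e 1)), ?_⟩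
  rw [← sub_eq_zero]
  refine eq_zero_of_pair_int_eq_zero fun x => ?_
  rw [map_sub, map_smul, pair_mkQ]
  conv_lhs => rw [← hr x]
  rw [hradd, pair_sum, smul_eq_mul, mul_sum, ← sum_sub_distrib, ← hradd, hr]
  refine sum_eq_zero fun e _ => ?_
  rw [pair_smul, hk]
  ring

/-- The values of a class on integral cycles form an ideal of `ℤ`; its generator is the content `c`,
and dividing by it leaves a primitive class `u`. -/
lemma exists_eq_smul_of_ne_zero {v : o.H1 ℤ} (hv : v ≠ 0) :
    ∃ c : ℤ, 0 < c ∧ ∃ u : o.H1 ℤ, ∃ x : o.cycles ℤ, v = c • u ∧ pair x u = 1 := by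
  let I : Submodule ℤ ℤ :=
    { carrier := Set.range fun x : o.cycles ℤ => pair x v
      add_mem' := by
        rintro _ _ ⟨x, rfl⟩ ⟨y, rfl⟩
        exact ⟨x + y, pair_add x y v⟩
      zero_mem' := ⟨0, by simpa using pair_smul (0 : ℤ) (0 : o.cycles ℤ) v⟩
      smul_mem' := by
        rintro c _ ⟨x, rfl⟩
        exact ⟨c • x, pair_smul c x v⟩ }
  obtain ⟨c, hc⟩ := (IsPrincipalIdealRing.principal (I : Ideal ℤ)).principal
  have hmem : ∀ x : o.cycles ℤ, |c| ∣ pair x v := by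
    intro x
    rw [abs_dvd]
    have : pair x v ∈ I := ⟨x, rfl⟩
    rw [hc] at this
    exact Ideal.mem_span_singleton.1 this
  have hcI : |c| ∈ I := by
    rw [hc]
    exact Ideal.mem_span_singleton.2 ((dvd_abs c c).2 dvd_rfl)
  obtain ⟨u, hu⟩ := exists_smul_eq_of_dvd_pair _ hmem
  have hc0 : c ≠ 0 := by
    rintro rfl
    exact hv (by simpa using hu)
  obtain ⟨x, hx⟩ := hcI
  refine ⟨|c|, abs_pos.2 hc0, u, x, hu, ?_⟩
  change pair x v = |c| at hx
  rw [hu, map_smul, smul_eq_mul] at hx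
  exact mul_left_cancel₀ (abs_pos.2 hc0).ne' (by rw [hx, mul_one])

end Cast

/-! ### Random integral cycles with prescribed mean -/

section Moment

variable {α β : Type*} {G : Graph α β} [Fintype G.edgeSet] {o : G.Orientation}

open Classical in
/-- The edges on which a rational chain is not an integer. -/
noncomputable def fractional (y : G.edgeSet → ℚ) : Finset G.edgeSet :=
  {e | y e ∉ (Int.castRingHom ℚ).range}

lemma mem_fractional {y : G.edgeSet → ℚ} {e : G.edgeSet} :
    e ∈ fractional y ↔ y e ∉ (Int.castRingHom ℚ).range := by
  simp [fractional]

/-- A vertex that meets the fractional edges of a cycle does so at least twice. -/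
lemma two_le_card_fractional [Finite G.vertexSet] [DecidableEq G.vertexSet]
    (y : o.cycles ℚ) (v : G.vertexSet)
    (hv : ∃ e ∈ fractional y.1, o.source e = v ∨ o.target e = v) :
    2 ≤ #{e ∈ fractional y.1 | o.source e = v} + #{e ∈ fractional y.1 | o.target e = v} := by
  classical
  -- If `e₀` were the only fractional edge at `v` and not a loop, conservation at `v` would write `y
  -- e₀` as an integral combination of integers. A fractional loop is already counted twice.
  have key : ∀ e₀ ∈ fractional y.1,
      (((if o.target e₀ = v then 1 else 0) - (if o.source e₀ = v then 1 else 0) : ℚ) = 1 ∨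
        ((if o.target e₀ = v then 1 else 0) - (if o.source e₀ = v then 1 else 0) : ℚ) = -1) →
      ¬ ∀ e ∈ fractional y.1, e ≠ e₀ → o.source e ≠ v ∧ o.target e ≠ v := by
    intro e₀ he₀ h1 h
    have hsum := mem_cycles_iff_vertex.1 y.2 v
    rw [← add_sum_erase univ _ (mem_univ e₀)] at hsum
    have hint : ∑ e ∈ univ.erase e₀, y.1 e *
        ((if o.target e = v then 1 else 0) - (if o.source e = v then 1 else 0))
          ∈ (Int.castRingHom ℚ).range := by
      refine sum_mem fun e he => ?_
      by_cases hef : e ∈ fractional y.1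
      · obtain ⟨h2, h3⟩ := h e hef (ne_of_mem_erase he)
        simp [h2, h3]
      · rw [mem_fractional, not_not] at hef
        refine mul_mem hef (sub_mem ?_ ?_) <;> split_ifs <;>
          first | exact one_mem _ | exact zero_mem _
    refine mem_fractional.1 he₀ ?_
    rcases h1 with h1 | h1
    · rw [h1, mul_one] at hsum
      rw [eq_neg_of_add_eq_zero_left hsum]
      exact neg_mem hint
    · rw [h1, mul_neg_one, neg_add_eq_zero] at hsum
      rw [hsum]
      exact hint
  by_contra hlt
  push Not at hlt
  have hs : #{e ∈ fractional y.1 | o.source e = v} ≤ 1 := by omega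
  have ht : #{e ∈ fractional y.1 | o.target e = v} ≤ 1 := by omega
  obtain ⟨e₀, he₀, h | h⟩ := hv
  · have hpos : 0 < #{e ∈ fractional y.1 | o.source e = v} :=
      card_pos.2 ⟨e₀, mem_filter.2 ⟨he₀, h⟩⟩
    have ht0 : #{e ∈ fractional y.1 | o.target e = v} = 0 := by omega
    have htn : ∀ e ∈ fractional y.1, o.target e ≠ v := by
      rw [card_eq_zero, filter_eq_empty_iff] at ht0
      exact fun e he => ht0 he
    refine key e₀ he₀ (Or.inr (by simp [h, htn e₀ he₀])) fun e he hne => ⟨fun hev => hne ?_, htn e he⟩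
    exact card_le_one.1 hs _ (mem_filter.2 ⟨he, hev⟩) _ (mem_filter.2 ⟨he₀, h⟩)
  · have hpos : 0 < #{e ∈ fractional y.1 | o.target e = v} :=
      card_pos.2 ⟨e₀, mem_filter.2 ⟨he₀, h⟩⟩
    have hs0 : #{e ∈ fractional y.1 | o.source e = v} = 0 := by omega
    have hsn : ∀ e ∈ fractional y.1, o.source e ≠ v := by
      rw [card_eq_zero, filter_eq_empty_iff] at hs0
      exact fun e he => hs0 he
    refine key e₀ he₀ (Or.inl (by simp [h, hsn e₀ he₀])) fun e he hne => ⟨hsn e he, fun hev => hne ?_⟩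
    exact card_le_one.1 ht _ (mem_filter.2 ⟨he, hev⟩) _ (mem_filter.2 ⟨he₀, h⟩)

/-- The fractional edges of a rational cycle support a nonzero cycle. -/
lemma exists_cycle_supported_on_fractional [Finite G.vertexSet] (y : o.cycles ℚ)
    (hy : (fractional y.1).Nonempty) :
    ∃ d : o.cycles ℚ, d ≠ 0 ∧ ∀ e ∉ fractional y.1, d.1 e = 0 := by
  classical
  set F := fractional y.1
  set T := F.image o.source ∪ F.image o.target
  have hsT : ∀ e ∈ F, o.source e ∈ T := fun e he => mem_union_left _ (mem_image_of_mem _ he)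
  have htT : ∀ e ∈ F, o.target e ∈ T := fun e he => mem_union_right _ (mem_image_of_mem _ he)
  have hcard : #T ≤ #F := by
    have h1 := card_eq_sum_card_fiberwise (f := o.source) (s := F) (t := T) hsT
    have h2 := card_eq_sum_card_fiberwise (f := o.target) (s := F) (t := T) htT
    have h3 : ∑ v ∈ T, 2 ≤ ∑ v ∈ T, (#{e ∈ F | o.source e = v} + #{e ∈ F | o.target e = v}) := by
      refine sum_le_sum fun v hv => two_le_card_fractional y v ?_
      rcases mem_union.1 hv with h | h <;> obtain ⟨e, he, hev⟩ := mem_image.1 h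
      · exact ⟨e, he, Or.inl hev⟩
      · exact ⟨e, he, Or.inr hev⟩
    rw [sum_add_distrib, ← h1, ← h2, sum_const, smul_eq_mul] at h3
    omega
  obtain ⟨e₀, he₀⟩ := hy
  let v₀ := o.source e₀
  -- Dropping `v₀` leaves fewer equations than unknowns; conservation at `v₀` then follows because
  -- the boundary of any chain sums to zero.
  let bd : (F → ℚ) →ₗ[ℚ] (T.erase v₀ → ℚ) := LinearMap.pi fun v =>
    ∑ e : F, (((if o.target e = v then 1 else 0) - (if o.source e = v then 1 else 0) : ℚ) •
      LinearMap.proj (R := ℚ) e)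
  have hlt : Module.finrank ℚ (T.erase v₀ → ℚ) < Module.finrank ℚ (F → ℚ) := by
    rw [Module.finrank_fintype_fun_eq_card, Module.finrank_fintype_fun_eq_card,
      Fintype.card_coe, Fintype.card_coe]
    exact (card_erase_lt_of_mem (hsT e₀ he₀)).trans_le hcard
  obtain ⟨x, hx, hx0⟩ := (Submodule.ne_bot_iff _).1 (LinearMap.ker_ne_bot_of_finrank_lt (f := bd) hlt)
  let d : G.edgeSet → ℚ := fun e => if h : e ∈ F then x ⟨e, h⟩ else 0
  have hd : ∀ e ∉ F, d e = 0 := fun e he => dif_neg he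
  have hbd : ∀ v ∈ T.erase v₀, ∑ e, d e *
      ((if o.target e = v then 1 else 0) - (if o.source e = v then 1 else 0)) = 0 := by
    intro v hv
    have := congrFun hx ⟨v, hv⟩
    simp only [bd, LinearMap.pi_apply, LinearMap.sum_apply, LinearMap.smul_apply,
      LinearMap.proj_apply, smul_eq_mul, Pi.zero_apply] at this
    rw [← sum_subset (subset_univ F) (fun e _ he => by rw [hd e he, zero_mul]), ← sum_attach]
    refine Eq.trans (sum_congr rfl fun e _ => ?_) this
    rw [mul_comm]
    congr 1
    simp [d]
  have hbd' : ∀ v ≠ v₀, ∑ e, d e *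
      ((if o.target e = v then 1 else 0) - (if o.source e = v then 1 else 0)) = 0 := by
    intro v hv
    by_cases hvT : v ∈ T
    · exact hbd v (mem_erase.2 ⟨hv, hvT⟩)
    · refine sum_eq_zero fun e _ => ?_
      by_cases he : e ∈ F
      · rw [if_neg (fun h => hvT (by rw [← h]; exact htT e he)),
          if_neg (fun h => hvT (by rw [← h]; exact hsT e he)), sub_zero, mul_zero]
      · rw [hd e he, zero_mul]
  refine ⟨⟨d, ?_⟩, ?_, hd⟩
  · rw [mem_cycles_iff_vertex]
    intro v
    by_cases hv : v = v₀
    · subst hv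
      have := Fintype.ofFinite G.vertexSet
      have htot : ∑ v : G.vertexSet, ∑ e, d e *
          ((if o.target e = v then 1 else 0) - (if o.source e = v then 1 else 0)) = 0 := by
        rw [sum_comm]
        simp [← mul_sum, sum_sub_distrib]
      rwa [← add_sum_erase univ _ (mem_univ v₀),
        sum_eq_zero (s := univ.erase v₀) fun v hv => hbd' v (ne_of_mem_erase hv), add_zero] at htot
    · exact hbd' v hv
  · intro h
    refine hx0 (funext fun e => ?_)
    have := congrFun (congrArg Subtype.val h) e.1
    simpa [d] using this

/-- Moving a cycle `y` in the direction of a cycle supported on its fractional edges until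
one more edge becomes integral. -/
lemma exists_push (l : G.edgeSet → ℤ) (y d : o.cycles ℚ)
    (hy : ∀ e, (l e : ℚ) ≤ y.1 e ∧ y.1 e ≤ l e + 1) (hd0 : d ≠ 0)
    (hd : ∀ e ∉ fractional y.1, d.1 e = 0) :
    ∃ s : ℚ, 0 < s ∧ (∀ e, (l e : ℚ) ≤ (y + s • d).1 e ∧ (y + s • d).1 e ≤ l e + 1) ∧
      #(fractional (y + s • d).1) < #(fractional y.1) := by
  classical
  have hval : ∀ (s : ℚ) e, (y + s • d).1 e = y.1 e + s * d.1 e := fun s e => rfl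
  -- The time at which coordinate `e`, moving with speed `d e`, reaches the wall of its interval;
  -- the first such time is the step length.
  let r : G.edgeSet → ℚ := fun e =>
    if 0 < d.1 e then (l e + 1 - y.1 e) / d.1 e else (l e - y.1 e) / d.1 e
  have hne : ({e | d.1 e ≠ 0} : Finset G.edgeSet).Nonempty := by
    by_contra h
    rw [not_nonempty_iff_eq_empty, filter_eq_empty_iff] at h
    exact hd0 (Subtype.ext (funext fun e => not_not.1 (h (mem_univ e))))
  obtain ⟨e₀, he₀, hmin⟩ := exists_min_image _ r hne
  have hde₀ : d.1 e₀ ≠ 0 := (mem_filter.1 he₀).2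
  have hfrac : e₀ ∈ fractional y.1 := by
    by_contra h
    exact hde₀ (hd e₀ h)
  have hend : y.1 e₀ + r e₀ * d.1 e₀ = l e₀ ∨ y.1 e₀ + r e₀ * d.1 e₀ = l e₀ + 1 := by
    by_cases hp : 0 < d.1 e₀
    · right
      simp only [r, if_pos hp]
      field_simp
      ring
    · left
      simp only [r, if_neg hp]
      field_simp
      ring
  have hl : y.1 e₀ ≠ l e₀ := fun h => mem_fractional.1 hfrac ⟨l e₀, by simp [h]⟩
  have hu : y.1 e₀ ≠ l e₀ + 1 := fun h => mem_fractional.1 hfrac ⟨l e₀ + 1, by simp [h]⟩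
  have hpos : 0 < r e₀ := by
    by_cases hp : 0 < d.1 e₀
    · simp only [r, if_pos hp]
      exact div_pos (sub_pos.2 (lt_of_le_of_ne (hy e₀).2 hu)) hp
    · simp only [r, if_neg hp]
      exact div_pos_of_neg_of_neg (sub_neg.2 (lt_of_le_of_ne (hy e₀).1 hl.symm))
        (lt_of_le_of_ne (not_lt.1 hp) hde₀)
  refine ⟨r e₀, hpos, fun e => ?_, ?_⟩
  · rw [hval]
    by_cases hz : d.1 e = 0
    · rw [hz, mul_zero, add_zero]
      exact hy e
    · have hle := hmin e (mem_filter.2 ⟨mem_univ e, hz⟩)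
      by_cases hp : 0 < d.1 e
      · simp only [r, if_pos hp] at hle
        rw [le_div_iff₀ hp] at hle
        constructor
        · have := mul_pos hpos hp
          linarith [(hy e).1]
        · linarith
      · have hn : d.1 e < 0 := lt_of_le_of_ne (not_lt.1 hp) hz
        have hle' : r e₀ ≤ (l e - y.1 e) / d.1 e := by
          have h2 : r e = (l e - y.1 e) / d.1 e := if_neg hp
          rwa [h2] at hle
        rw [le_div_iff_of_neg hn] at hle'
        constructor
        · linarith
        · have := mul_neg_of_pos_of_neg hpos hn
          linarith [(hy e).2]
  · refine card_lt_card ((ssubset_iff_of_subset fun e he => ?_).2 ⟨e₀, hfrac, ?_⟩)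
    · by_contra hn
      rw [mem_fractional, hval, hd e hn, mul_zero, add_zero] at he
      exact hn (mem_fractional.2 he)
    · rw [mem_fractional, not_not, hval]
      rcases hend with h | h
      · exact ⟨l e₀, by simp [h]⟩
      · exact ⟨l e₀ + 1, by simp [h]⟩

/-- The quadratic form `M` behaves like the second moment of a random integral cycle with mean `y`,
all of whose values on an edge `e` are `l e` or `l e + 1`. -/
structure IsMoment (l : G.edgeSet → ℤ) (y : o.cycles ℚ) (M : QuadraticForm ℚ (o.H1 ℚ)) :
    Prop where
  coedge : ∀ e, M (o.coeffMap ℚ (o.coedge e)) = (2 * l e + 1) * y.1 e - l e * (l e + 1)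
  int_le : ∀ (v : o.H1 ℤ) (n : ℤ),
    (2 * n + 1) * pair y (o.coeffMap ℚ v) - n * (n + 1) ≤ M (o.coeffMap ℚ v)
  sq_le : ∀ v : o.H1 ℚ, pair y v ^ 2 ≤ M v

/-- Mixing two random cycles mixes their means and second moments; only `sq_le` is not linear, and
it uses convexity of the square. -/
lemma IsMoment.convex {l : G.edgeSet → ℤ} {a b : o.cycles ℚ} {A B : QuadraticForm ℚ (o.H1 ℚ)}
    (hA : IsMoment l a A) (hB : IsMoment l b B) {s t : ℚ} (hs : 0 ≤ s) (ht : 0 ≤ t)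
    (hst : s + t = 1) : IsMoment l (s • a + t • b) (s • A + t • B) where
  coedge e := by
    have h : (s • a + t • b).1 e = s * a.1 e + t * b.1 e := rfl
    rw [h, add_apply, smul_apply, smul_apply, hA.coedge,
      hB.coedge, smul_eq_mul, smul_eq_mul]
    obtain rfl : t = 1 - s := by linarith
    ring
  int_le v n := by
    rw [pair_add, pair_smul, pair_smul, add_apply, smul_apply,
      smul_apply, smul_eq_mul, smul_eq_mul]
    have h1 := mul_le_mul_of_nonneg_left (hA.int_le v n) hs
    have h2 := mul_le_mul_of_nonneg_left (hB.int_le v n) ht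
    obtain rfl : t = 1 - s := by linarith
    linarith
  sq_le v := by
    rw [pair_add, pair_smul, pair_smul, add_apply, smul_apply,
      smul_apply, smul_eq_mul, smul_eq_mul]
    have h1 := mul_le_mul_of_nonneg_left (hA.sq_le v) hs
    have h2 := mul_le_mul_of_nonneg_left (hB.sq_le v) ht
    have h3 := mul_nonneg (mul_nonneg hs ht) (sq_nonneg (pair a v - pair b v))
    obtain rfl : t = 1 - s := by linarith
    linarith

/-- Integrality of the vertices of the polytope of cycles in the box, by induction on the number of
fractional edges: `y` lies on a segment whose two ends have fewer of them. -/
lemma exists_isMoment [Finite G.vertexSet] (l : G.edgeSet → ℤ) (y : o.cycles ℚ)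
    (hy : ∀ e, (l e : ℚ) ≤ y.1 e ∧ y.1 e ≤ l e + 1) :
    ∃ M, IsMoment l y M := by
  induction hk : #(fractional y.1) using Nat.strong_induction_on generalizing y with
  | _ k ih =>
  by_cases hF : (fractional y.1).Nonempty
  · obtain ⟨d, hd0, hd⟩ := exists_cycle_supported_on_fractional y hF
    obtain ⟨s, hs, hbox, hlt⟩ := exists_push l y d hy hd0 hd
    obtain ⟨t, ht, hbox', hlt'⟩ := exists_push l y (-d) hy (neg_ne_zero.2 hd0)
      fun e he => by
        change -(d.1 e) = 0
        rw [hd e he, neg_zero]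
    obtain ⟨A, hA⟩ := ih _ (hk ▸ hlt) _ hbox rfl
    obtain ⟨B, hB⟩ := ih _ (hk ▸ hlt') _ hbox' rfl
    have hst : 0 < s + t := add_pos hs ht
    -- The weights for which the ends `y + s • d` and `y - t • d` have mean `y`.
    refine ⟨(t / (s + t)) • A + (s / (s + t)) • B, ?_⟩
    have h := hA.convex hB (s := t / (s + t)) (t := s / (s + t)) (by positivity) (by positivity)
      (by field_simp; ring)
    convert h using 1
    ext e
    change y.1 e = t / (s + t) * (y.1 e + s * d.1 e) + s / (s + t) * (y.1 e + t * -(d.1 e))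
    field_simp
    ring
  · have hint : ∀ e, ∃ n : ℤ, (n : ℚ) = y.1 e := by
      intro e
      by_contra h
      exact hF ⟨e, mem_fractional.2 h⟩
    choose n hn using hint
    -- The cycle `y` is integral: the random cycle is constant.
    refine ⟨QuadraticMap.linMulLin (pair y) (pair y), fun e => ?_, fun v m => ?_, fun v => ?_⟩
    · rw [QuadraticMap.linMulLin_apply, pair_coeffMap_coedge]
      have h := hy e
      rw [← hn e] at h ⊢
      obtain ⟨h1, h2⟩ := h
      have h1' : l e ≤ n e := by exact_mod_cast h1
      have h2' : n e ≤ l e + 1 := by exact_mod_cast h2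
      obtain h3 | h3 : n e = l e ∨ n e = l e + 1 := by omega
      · rw [h3]; ring
      · rw [h3]; push_cast; ring
    · rw [QuadraticMap.linMulLin_apply]
      obtain ⟨u, rfl⟩ := Submodule.mkQ_surjective _ v
      obtain ⟨k, hk⟩ : ∃ k : ℤ, (k : ℚ) = pair y (o.coeffMap ℚ
          ((LinearMap.range (o.coboundary ℤ)).mkQ u)) := by
        refine ⟨∑ e, n e * u e, ?_⟩
        rw [coeffMap_mkQ, pair_mkQ]
        push_cast
        exact sum_congr rfl fun e _ => by rw [hn]
      rw [← hk]
      -- No integer lies strictly between `m` and `m + 1`; expanding this product gives `int_le`.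
      have : 0 ≤ (k - m) * (k - m - 1) := by
        rcases lt_or_ge m k with h | h
        · exact mul_nonneg (by omega) (by omega)
        · exact mul_nonneg_of_nonpos_of_nonpos (by omega) (by omega)
      have h' : (0 : ℚ) ≤ (k - m) * (k - m - 1) := by exact_mod_cast this
      linarith
    · rw [QuadraticMap.linMulLin_apply, sq]

end Moment

/-! ### Averaging variances over torsion points -/

section Emm

variable {α β : Type*} {G : Graph α β} {o : G.Orientation}

/-- A potential with coboundary `e*` is constant along all other edges; these still join the ends of
`e`, so it cannot jump by `1` across `e`. -/
lemma coedge_ne_zero {e : G.edgeSet} (he : ¬ G.IsBridge e) : o.coedge e ≠ 0 := by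
  classical
  intro h
  obtain ⟨f, hf⟩ := (Submodule.Quotient.mk_eq_zero _).1 h
  have hf' : ∀ e', f (o.target e') - f (o.source e') = Pi.single (M := fun _ => ℤ) e 1 e' :=
    fun e' => congrFun hf e'
  have hreach : (G.deleteEdges {e.1}).Reachable (o.source e) (o.target e) := by
    by_contra hn
    exact he ⟨_, _, o.isLink e, hn⟩
  have key : ∀ z, (G.deleteEdges {e.1}).Reachable (o.source e) z →
      ∃ hz : z ∈ G.vertexSet, f ⟨z, hz⟩ = f (o.source e) := by
    intro z hz
    induction hz with
    | refl => exact ⟨(o.source e).2, rfl⟩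
    | tail _ hadj ih =>
      obtain ⟨hb, hfb⟩ := ih
      obtain ⟨e', hl⟩ := hadj
      rw [deleteEdges_isLink] at hl
      obtain ⟨hl, hne⟩ := hl
      have hne' : (⟨e', hl.edge_mem⟩ : G.edgeSet) ≠ e := fun h => hne (by rw [← h]; rfl)
      have h0 := hf' ⟨e', hl.edge_mem⟩
      rw [Pi.single_eq_of_ne hne', sub_eq_zero] at h0
      refine ⟨hl.right_mem, ?_⟩
      rcases hl.eq_and_eq_or_eq_and_eq (o.isLink ⟨e', hl.edge_mem⟩) with ⟨h1, h2⟩ | ⟨h1, h2⟩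
      · rw [← hfb]
        convert h0 using 2 <;> exact Subtype.ext (by assumption)
      · rw [← hfb]
        convert h0.symm using 2 <;> exact Subtype.ext (by assumption)
  obtain ⟨_, h1⟩ := key _ hreach
  have h2 := hf' e
  rw [Pi.single_eq_same] at h2
  have h3 : f (o.target e) = f (o.source e) := h1
  omega

variable [Fintype G.edgeSet] [Finite G.vertexSet]

/-- Coedges are primitive. If `e* = c • u`, a moment form with mean `1/2` on `e` has `M e* = 1/2`,
whereas `int_le` with `n = 0` gives `M u ≥ 1/(2c)`, hence `M e* ≥ c/2` and `c ≤ 1`. -/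
lemma exists_pair_coedge_eq_one {e : G.edgeSet} (he : ¬ G.IsBridge e) :
    ∃ x : o.cycles ℤ, pair x (o.coedge e) = 1 := by
  obtain ⟨c, hc, u, x, hu, hx⟩ := exists_eq_smul_of_ne_zero (coedge_ne_zero (o := o) he)
  have hxe : pair x (o.coedge e) = c := by rw [hu, map_smul, hx, smul_eq_mul, mul_one]
  have hc' : (0 : ℚ) < c := by exact_mod_cast hc
  let y : o.cycles ℚ := (1 / (2 * c) : ℚ) • castCycle x
  have hye : y.1 e = 1 / 2 := by
    have h1 : y.1 e = 1 / (2 * c) * (x.1 e : ℚ) := rfl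
    rw [h1, ← pair_coedge, hxe]
    field_simp
  obtain ⟨M, hM⟩ := exists_isMoment (fun e => ⌊y.1 e⌋) y
    fun e => ⟨Int.floor_le _, (Int.lt_floor_add_one _).le⟩
  have h1 := hM.coedge e
  have h2 := hM.int_le u 0
  have h3 : pair y (o.coeffMap ℚ u) = 1 / (2 * c) := by
    rw [pair_smul, pair_castCycle, hx, Int.cast_one, mul_one]
  have hfl : ⌊(1 / 2 : ℚ)⌋ = 0 := by norm_num
  have h4 : M (o.coeffMap ℚ (o.coedge e)) = c * c * M (o.coeffMap ℚ u) := by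
    rw [hu, map_smul, ← Int.cast_smul_eq_zsmul ℚ, QuadraticMap.map_smul, smul_eq_mul]
  rw [h4, hye, hfl] at h1
  rw [h3] at h2
  have h5 : (c : ℚ) ≤ 1 := by
    norm_num at h1 h2
    have h6 := mul_le_mul_of_nonneg_left h2 (mul_pos hc' hc').le
    rw [h1] at h6
    field_simp at h6
    linarith
  have h6 : c = 1 := le_antisymm (by exact_mod_cast h5) hc
  exact ⟨x, by rw [hxe, h6]⟩

variable {ι : Type*} [Fintype ι] (N : ℕ)

/-- The integral cycle with coordinates in `{0, …, N - 1}` in the class `x` modulo `N`. -/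
noncomputable def residueCycle (b : Module.Basis ι ℤ (o.cycles ℤ)) (x : ι → ZMod N) : o.cycles ℤ :=
  ∑ i, ((x i).val : ℤ) • b i

/-- The `N`-torsion point of the torus of real cycles modulo integral cycles that corresponds to
the class `x`, lifted to a rational cycle. -/
noncomputable def torsionCycle (b : Module.Basis ι ℤ (o.cycles ℤ)) (x : ι → ZMod N) : o.cycles ℚ :=
  (1 / N : ℚ) • castCycle (residueCycle N b x)

/-- The evaluation of a cohomology class on cycles modulo `N`. -/
noncomputable def pairMod (b : Module.Basis ι ℤ (o.cycles ℤ)) (v : o.H1 ℤ) : (ι → ZMod N) →+ ZMod N where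
  toFun x := ∑ i, x i * (pair (b i) v : ZMod N)
  map_zero' := by simp
  map_add' x y := by simp [add_mul, sum_add_distrib]

/-- The variance of a random variable with values `0` and `1` and mean `k / N`. -/
def residueVar (k : ZMod N) : ℚ := (k.val / N) * (1 - k.val / N)

variable {N} [DecidableEq ι]

omit [Finite G.vertexSet] [DecidableEq ι] in
lemma pair_residueCycle [NeZero N] (b : Module.Basis ι ℤ (o.cycles ℤ)) (x : ι → ZMod N)
    (v : o.H1 ℤ) : ((pair (residueCycle N b x) v : ℤ) : ZMod N) = pairMod N b v x := by
  rw [residueCycle, pair_sum]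
  simp [pair_smul, pairMod]

-- Both sides are `{t}(1 - {t})`, and `{t}` is the residue modulo `N` divided by `N`. The right side
-- is the form in which `IsMoment` supplies the variance.
omit [DecidableEq ι] in
lemma residueVar_pairMod [NeZero N] (b : Module.Basis ι ℤ (o.cycles ℤ)) (x : ι → ZMod N)
    (v : o.H1 ℤ) {t : ℚ} (ht : pair (torsionCycle N b x) (o.coeffMap ℚ v) = t) :
    residueVar N (pairMod N b v x) = (2 * ⌊t⌋ + 1) * t - ⌊t⌋ * (⌊t⌋ + 1) - t ^ 2 := by
  have hN : (0 : ℚ) < N := by exact_mod_cast NeZero.pos N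
  rw [torsionCycle, pair_smul, pair_castCycle] at ht
  rw [residueVar, ← pair_residueCycle]
  set m := pair (residueCycle N b x) v
  have hval : (((m : ZMod N).val : ℤ)) = m % N := ZMod.val_intCast m
  have hval' : ((m : ZMod N).val : ℚ) = m - N * (m / N : ℤ) := by
    have h1 : (m : ℚ) = ((m % N : ℤ) : ℚ) + N * (m / N : ℤ) := by
      exact_mod_cast (Int.emod_add_mul_ediv m N).symm
    rw [← hval] at h1
    push_cast at h1
    linarith
  have hfl : ⌊t⌋ = m / N := by
    rw [← ht, one_div_mul_eq_div]
    exact_mod_cast Rat.floor_intCast_div_natCast m N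
  rw [hval', hfl, ← ht]
  field_simp
  ring

omit [Finite G.vertexSet] [DecidableEq ι] in
lemma pairMod_surjective [NeZero N] (b : Module.Basis ι ℤ (o.cycles ℤ)) {v : o.H1 ℤ}
    {x : o.cycles ℤ} (hx : pair x v = 1) : Function.Surjective (pairMod N b v) := by
  intro k
  refine ⟨fun i => k * (b.repr x i : ZMod N), ?_⟩
  have h := congrArg (Int.cast : ℤ → ZMod N) hx
  rw [← b.sum_repr x, pair_sum] at h
  simp only [pair_smul] at h
  push_cast at h
  change ∑ i, k * (b.repr x i : ZMod N) * (pair (b i) v : ZMod N) = k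
  simp_rw [mul_assoc]
  rw [← mul_sum, h, mul_one]

/-- All fibres of a surjective homomorphism have equal size, so the sum does not depend on `h`. -/
lemma sum_residueVar [NeZero N] {h : (ι → ZMod N) →+ ZMod N} (hs : Function.Surjective h) :
    ∑ x, residueVar N (h x) =
      ((N : ℚ) ^ Fintype.card ι / N) * ∑ k, residueVar N k := by
  classical
  have hN : (N : ℚ) ≠ 0 := by exact_mod_cast NeZero.ne N
  have hfib : ∀ k, #{x | h x = k} = #{x | h x = 0} := fun k =>
    AddMonoidHom.card_fiber_eq_of_mem_range h (hs k) (hs 0)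
  have hcard : (N : ℚ) ^ Fintype.card ι = N * #{x | h x = 0} := by
    have h1 := card_eq_sum_card_fiberwise (f := h) (s := univ) (t := univ) (by simp)
    simp only [hfib, sum_const, card_univ, ZMod.card, smul_eq_mul, Fintype.card_pi,
      prod_const] at h1
    exact_mod_cast h1
  rw [hcard, mul_div_cancel_left₀ _ hN, mul_sum, ← sum_fiberwise univ h]
  refine sum_congr rfl fun k _ => ?_
  rw [← hfib k, ← nsmul_eq_mul]
  exact sum_eq_card_nsmul fun x hx => by rw [(mem_filter.1 hx).2]

lemma sum_residueVar_pos [NeZero N] (hN : 2 ≤ N) : 0 < ∑ k, residueVar N k := by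
  have hN0 : (0 : ℚ) < N := by exact_mod_cast NeZero.pos N
  have hlt : ∀ k : ZMod N, (k.val : ℚ) / N < 1 := fun k => by
    rw [div_lt_one hN0]
    exact_mod_cast ZMod.val_lt k
  refine sum_pos' (fun k _ => mul_nonneg (by positivity) (sub_nonneg.2 (hlt k).le))
    ⟨1, mem_univ _, mul_pos ?_ (sub_pos.2 (hlt 1))⟩
  have : Fact (1 < N) := ⟨hN⟩
  rw [ZMod.val_one]
  positivity

lemma exists_isEmm_of_isMoment [NeZero N] (hN : 2 ≤ N) (b : Module.Basis ι ℤ (o.cycles ℤ))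
    (M : (ι → ZMod N) → QuadraticForm ℚ (o.H1 ℚ))
    (hM : ∀ x, IsMoment (fun e => ⌊(torsionCycle N b x).1 e⌋) (torsionCycle N b x) (M x)) :
    ∃ q : QuadraticForm ℚ (o.H1 ℚ), o.IsEmm q ∧ ∀ w : o.H1 ℤ, (∃ x : o.cycles ℤ, pair x w = 1) →
      (∃ x, ∃ n : ℤ, pair (torsionCycle N b x) (o.coeffMap ℚ w) = n ∧
        (n : ℚ) ^ 2 < M x (o.coeffMap ℚ w)) → 1 < q (o.coeffMap ℚ w) := by
  set K : ℚ := ((N : ℚ) ^ Fintype.card ι / N) * ∑ k, residueVar N k with hK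
  have hKpos : 0 < K := by
    have hN0 : (0 : ℚ) < N := by exact_mod_cast NeZero.pos N
    exact mul_pos (by positivity) (sum_residueVar_pos hN)
  -- The sum of the variances, normalized so that the common lower bound for primitive classes is
  -- `1`.
  let q : QuadraticForm ℚ (o.H1 ℚ) := K⁻¹ • ∑ x, (M x -
    QuadraticMap.linMulLin (pair (torsionCycle N b x)) (pair (torsionCycle N b x)))
  have hq : ∀ v, q v = K⁻¹ * ∑ x, (M x v - pair (torsionCycle N b x) v ^ 2) := by
    intro v
    simp only [q, smul_apply, smul_eq_mul, _root_.sum_apply, sub_apply,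
      QuadraticMap.linMulLin_apply, sq]
  have hle : ∀ (v : o.H1 ℤ) x, residueVar N (pairMod N b v x) ≤
      M x (o.coeffMap ℚ v) - pair (torsionCycle N b x) (o.coeffMap ℚ v) ^ 2 := by
    intro v x
    rw [residueVar_pairMod b x v rfl]
    linarith [(hM x).int_le v ⌊pair (torsionCycle N b x) (o.coeffMap ℚ v)⌋]
  have hone : ∀ (v : o.H1 ℤ) (x : o.cycles ℤ), pair x v = 1 →
      K⁻¹ * ∑ x, residueVar N (pairMod N b v x) = 1 := by
    intro v x hx
    rw [sum_residueVar (pairMod_surjective b hx), ← hK, inv_mul_cancel₀ hKpos.ne']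
  have hprim : ∀ (v : o.H1 ℤ) (x : o.cycles ℤ), pair x v = 1 → 1 ≤ q (o.coeffMap ℚ v) := by
    intro v x hx
    rw [hq, ← hone v x hx]
    exact mul_le_mul_of_nonneg_left (sum_le_sum fun x _ => hle v x) (inv_nonneg.2 hKpos.le)
  have hint : ∀ v : o.H1 ℤ, v ≠ 0 → 1 ≤ q (o.coeffMap ℚ v) := by
    intro v hv
    obtain ⟨c, hc, u, x, rfl, hx⟩ := exists_eq_smul_of_ne_zero hv
    have h1 := hprim u x hx
    have hc1 : (1 : ℚ) ≤ c := by exact_mod_cast hc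
    rw [map_smul, ← Int.cast_smul_eq_zsmul ℚ, QuadraticMap.map_smul, smul_eq_mul]
    nlinarith
  refine ⟨q, ⟨?_, ?_, hint⟩, ?_⟩
  · intro v hv
    -- Positivity follows from the bound on integral classes after clearing denominators.
    obtain ⟨n, hn, w, hw⟩ := exists_nat_smul_eq_coeffMap v
    have hn' : (0 : ℚ) < n := by exact_mod_cast hn
    have hw0 : w ≠ 0 := by
      rintro rfl
      rw [map_zero] at hw
      exact smul_ne_zero hn'.ne' hv hw.symm
    have h1 := hint w hw0
    rw [hw, QuadraticMap.map_smul, smul_eq_mul] at h1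
    by_contra h
    have h2 := mul_nonpos_of_nonneg_of_nonpos (mul_pos hn' hn').le (not_lt.1 h)
    linarith
  · intro e he
    obtain ⟨x, hx⟩ := exists_pair_coedge_eq_one (o := o) he
    rw [hq, ← hone _ x hx]
    congr 1
    refine sum_congr rfl fun x _ => ?_
    rw [residueVar_pairMod b x _ rfl, (hM x).coedge, pair_coeffMap_coedge]
  · rintro w ⟨x, hx⟩ ⟨x₀, n, hn, hlt⟩
    rw [hq, ← hone w x hx]
    refine mul_lt_mul_of_pos_left (sum_lt_sum (fun x _ => hle w x) ⟨x₀, mem_univ _, ?_⟩)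
      (inv_pos.2 hKpos)
    -- At an integral mean the lower bound is `0`, so any positive variance makes the sum strictly
    -- larger.
    rw [residueVar_pairMod b x₀ w hn, hn, Int.floor_intCast]
    linarith

omit [DecidableEq ι] in
/-- A translate of any rational cycle by an integral cycle is a torsion point. -/
lemma exists_torsionCycle_eq_add [NeZero N]
    (b : Module.Basis ι ℤ (o.cycles ℤ)) (y : o.cycles ℚ)
    {Y : o.cycles ℤ} (hY : castCycle Y = (N : ℚ) • y) :
    ∃ (x : ι → ZMod N) (Z : o.cycles ℤ), torsionCycle N b x = y + castCycle Z := by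
  have hN : (N : ℚ) ≠ 0 := by exact_mod_cast NeZero.ne N
  refine ⟨fun i => (b.repr Y i : ZMod N), -∑ i, (b.repr Y i / N) • b i, ?_⟩
  have h1 : residueCycle N b (fun i => (b.repr Y i : ZMod N)) =
      Y - (N : ℤ) • ∑ i, (b.repr Y i / N) • b i := by
    rw [residueCycle, eq_sub_iff_add_eq, smul_sum, ← sum_add_distrib]
    conv_rhs => rw [← b.sum_repr Y]
    refine sum_congr rfl fun i _ => ?_
    rw [smul_smul, ← add_smul, ZMod.val_intCast, Int.emod_add_mul_ediv]
  ext e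
  have h2 := congrFun (congrArg Subtype.val hY) e
  have h2' : (Y.1 e : ℚ) = N * y.1 e := h2
  rw [torsionCycle, h1]
  set Z := ∑ i, (b.repr Y i / N) • b i
  change (1 / N : ℚ) * ((Y.1 e - (N : ℤ) * Z.1 e : ℤ) : ℚ) = y.1 e + ((-Z.1 e : ℤ) : ℚ)
  push_cast
  rw [h2']
  field_simp
  ring

end Emm

/-! ### Lengthening the superfluous minimal vectors -/

section Strong

variable {α β : Type*} {G : Graph α β} [Fintype G.edgeSet] [Finite G.vertexSet] {o : G.Orientation}

/-- A generic rational cycle has a moment form that is not concentrated on a given nonzero class. -/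
lemma exists_isMoment_lt (y : o.cycles ℚ) (hy : ∀ e, e ∈ fractional y.1) {v : o.H1 ℚ}
    (hv : v ≠ 0) : ∃ M, IsMoment (fun e => ⌊y.1 e⌋) y M ∧ pair y v ^ 2 < M v := by
  obtain ⟨d, hd⟩ : ∃ d : o.cycles ℚ, pair d v ≠ 0 := by
    by_contra h
    push Not at h
    exact hv (eq_zero_of_pair_eq_zero h)
  have hd0 : d ≠ 0 := by
    rintro rfl
    refine hd ?_
    simpa using pair_smul (0 : ℚ) (0 : o.cycles ℚ) v
  have hbox : ∀ e, ((⌊y.1 e⌋ : ℤ) : ℚ) ≤ y.1 e ∧ y.1 e ≤ (⌊y.1 e⌋ : ℤ) + 1 := fun e =>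
    ⟨Int.floor_le _, (Int.lt_floor_add_one _).le⟩
  -- With every edge fractional, `y` is interior to its box and can move in any direction, in
  -- particular one that `v` detects.
  obtain ⟨s, hs, hs', -⟩ := exists_push (fun e => ⌊y.1 e⌋) y d hbox hd0
    fun e he => absurd (hy e) he
  obtain ⟨t, ht, ht', -⟩ := exists_push (fun e => ⌊y.1 e⌋) y (-d) hbox (neg_ne_zero.2 hd0)
    fun e he => absurd (hy e) he
  obtain ⟨A, hA⟩ := exists_isMoment _ _ hs'
  obtain ⟨B, hB⟩ := exists_isMoment _ _ ht'
  have hst : 0 < s + t := add_pos hs ht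
  have hmean : y = (t / (s + t)) • (y + s • d) + (s / (s + t)) • (y + t • -d) := by
    ext e
    change y.1 e = t / (s + t) * (y.1 e + s * d.1 e) + s / (s + t) * (y.1 e + t * -(d.1 e))
    field_simp
    ring
  refine ⟨(t / (s + t)) • A + (s / (s + t)) • B, ?_, ?_⟩
  · have h := hA.convex hB (s := t / (s + t)) (t := s / (s + t)) (by positivity) (by positivity)
      (by field_simp; ring)
    rwa [← hmean] at h
  · rw [add_apply, smul_apply, smul_apply, smul_eq_mul, smul_eq_mul]
    have h1 := mul_le_mul_of_nonneg_left (hA.sq_le v) (div_pos ht hst).le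
    have h2 := mul_le_mul_of_nonneg_left (hB.sq_le v) (div_pos hs hst).le
    refine lt_of_lt_of_le ?_ (add_le_add h1 h2)
    have hneg : pair (-d) v = - pair d v := by
      rw [← neg_one_smul ℚ d, pair_smul, neg_one_mul]
    rw [pair_add, pair_add, pair_smul, pair_smul, hneg, ← sub_pos]
    -- The variance along `v` of the two-point distribution on the ends of the segment.
    have h3 : 0 < s * t * pair d v ^ 2 := by positivity
    refine lt_of_lt_of_eq h3 ?_
    field_simp
    ring

omit [Finite G.vertexSet] in
/-- If no coedge is a multiple of `w`, there is a cycle orthogonal to `w` with no integral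
coordinate. -/
lemma exists_pair_eq_zero_fractional {w : o.H1 ℚ} (hw : w ≠ 0)
    (h : ∀ (e : G.edgeSet) (c : ℚ), o.coeffMap ℚ (o.coedge e) ≠ c • w) :
    ∃ y : o.cycles ℚ, pair y w = 0 ∧ ∀ e, e ∈ fractional y.1 := by
  obtain ⟨y₀, hy₀⟩ : ∃ y : o.cycles ℚ, pair y w = 1 := by
    by_contra hn
    push Not at hn
    refine hw (eq_zero_of_pair_eq_zero fun x => ?_)
    by_contra hx
    exact hn ((pair x w)⁻¹ • x) (by rw [pair_smul, inv_mul_cancel₀ hx])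
  let φ : o.cycles ℚ →ₗ[ℚ] ℚ :=
    { toFun := fun y => pair y w
      map_add' := fun x y => pair_add x y w
      map_smul' := fun c x => pair_smul c x w }
  -- No coordinate vanishes on all of `w^⊥`, as its coedge would then be a multiple of `w`; finitely
  -- many proper subspaces do not cover a rational vector space.
  obtain ⟨y, hy, hye⟩ := Module.Dual.exists_forall_mem_ne_zero_of_forall_exists (LinearMap.ker φ)
    (fun e : G.edgeSet => (LinearMap.proj (R := ℚ) e).comp (o.cycles ℚ).subtype) (by
      intro e
      by_contra hn
      push Not at hn
      refine h e (y₀.1 e) (sub_eq_zero.1 (eq_zero_of_pair_eq_zero fun x => ?_))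
      rw [map_sub, map_smul, pair_coeffMap_coedge, smul_eq_mul]
      have h1 := hn (x - pair x w • y₀) (by
        rw [LinearMap.mem_ker, map_sub, map_smul]
        change pair x w - pair x w * pair y₀ w = 0
        rw [hy₀, mul_one, sub_self])
      have h2 : x.1 e - pair x w * y₀.1 e = 0 := h1
      rw [mul_comm]
      exact h2)
  have hye' : ∀ e, y.1 e ≠ 0 := hye
  have hy0 : pair y w = 0 := hy
  -- Dividing by `S` brings all coordinates strictly between `-1` and `1`; being nonzero, they are
  -- not integers.
  set S : ℚ := 1 + ∑ e, |y.1 e|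
  have hSpos : 0 < S := by
    have : 0 ≤ ∑ e, |y.1 e| := sum_nonneg fun e _ => abs_nonneg _
    linarith
  refine ⟨S⁻¹ • y, by rw [pair_smul, hy0, mul_zero], fun e => ?_⟩
  rw [mem_fractional]
  rintro ⟨n, hn⟩
  have hn' : (n : ℚ) = S⁻¹ * y.1 e := hn
  have hlt : |y.1 e| < S := by
    have := single_le_sum (f := fun e => |y.1 e|) (fun e _ => abs_nonneg _) (mem_univ e)
    linarith
  have habs : |(n : ℚ)| < 1 := by
    rw [hn', abs_mul, abs_inv, abs_of_pos hSpos, inv_mul_lt_one₀ hSpos]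
    exact hlt
  have hn0 : n = 0 := by
    rw [← Int.abs_lt_one_iff]
    exact_mod_cast habs
  rw [hn0, Int.cast_zero] at hn'
  exact mul_ne_zero (inv_ne_zero hSpos.ne') (hye' e) hn'.symm

/-- Every finite graph has an emm. -/
lemma exists_isEmm : ∃ q : QuadraticForm ℚ (o.H1 ℚ), o.IsEmm q := by
  classical
  let b := Module.Free.chooseBasis ℤ (o.cycles ℤ)
  choose M hM using fun x : Module.Free.ChooseBasisIndex ℤ (o.cycles ℤ) → ZMod 2 =>
    exists_isMoment (fun e => ⌊(torsionCycle 2 b x).1 e⌋) (torsionCycle 2 b x)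
      fun e => ⟨Int.floor_le _, (Int.lt_floor_add_one _).le⟩
  obtain ⟨q, hq, -⟩ := exists_isEmm_of_isMoment le_rfl b M hM
  exact ⟨q, hq⟩

/-- For every primitive integral class that is not proportional to a coedge there is an emm in which it is
longer than `1`. -/
lemma exists_isEmm_one_lt {w : o.H1 ℤ} (hx : ∃ x : o.cycles ℤ, pair x w = 1)
    (h : ∀ (e : G.edgeSet) (c : ℚ), o.coeffMap ℚ (o.coedge e) ≠ c • o.coeffMap ℚ w) :
    ∃ q : QuadraticForm ℚ (o.H1 ℚ), o.IsEmm q ∧ 1 < q (o.coeffMap ℚ w) := by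
  classical
  have hw : o.coeffMap ℚ w ≠ 0 := by
    intro h0
    obtain ⟨x, hx⟩ := hx
    rw [coeffMap_injective (h0.trans (map_zero _).symm), map_zero] at hx
    exact zero_ne_one hx
  obtain ⟨y, hyw, hy⟩ := exists_pair_eq_zero_fractional hw h
  obtain ⟨n, hn, Y, hY⟩ := exists_nat_smul_eq_castCycle y
  -- The factor `2` ensures `2 ≤ N`, even when `n = 1`.
  have : NeZero (2 * n) := ⟨by omega⟩
  let b := Module.Free.chooseBasis ℤ (o.cycles ℤ)
  have hY' : castCycle ((2 : ℤ) • Y) = ((2 * n : ℕ) : ℚ) • y := by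
    ext e
    have h2 := congrFun (congrArg Subtype.val hY) e
    have h2' : (Y.1 e : ℚ) = n * y.1 e := h2
    change ((2 * Y.1 e : ℤ) : ℚ) = ((2 * n : ℕ) : ℚ) * y.1 e
    push_cast
    rw [h2', mul_assoc]
  obtain ⟨x₀, Z, hx₀⟩ := exists_torsionCycle_eq_add b y hY'
  have hex : ∀ x, ∃ M, IsMoment (fun e => ⌊(torsionCycle (2 * n) b x).1 e⌋)
      (torsionCycle (2 * n) b x) M ∧ ((∀ e, e ∈ fractional (torsionCycle (2 * n) b x).1) →
        pair (torsionCycle (2 * n) b x) (o.coeffMap ℚ w) ^ 2 < M (o.coeffMap ℚ w)) := by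
    intro x
    by_cases hf : ∀ e, e ∈ fractional (torsionCycle (2 * n) b x).1
    · obtain ⟨M, hM, hlt⟩ := exists_isMoment_lt _ hf hw
      exact ⟨M, hM, fun _ => hlt⟩
    · obtain ⟨M, hM⟩ := exists_isMoment (fun e => ⌊(torsionCycle (2 * n) b x).1 e⌋)
        (torsionCycle (2 * n) b x) fun e => ⟨Int.floor_le _, (Int.lt_floor_add_one _).le⟩
      exact ⟨M, hM, fun hf' => absurd hf' hf⟩
  choose M hM hlt using hex
  obtain ⟨q, hq, hq'⟩ := exists_isEmm_of_isMoment (by omega) b M hM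
  have hpair : pair (torsionCycle (2 * n) b x₀) (o.coeffMap ℚ w) = (pair Z w : ℤ) := by
    rw [hx₀, pair_add, hyw, zero_add, pair_castCycle]
  refine ⟨q, hq, hq' w hx ⟨x₀, pair Z w, hpair, ?_⟩⟩
  rw [← hpair]
  refine hlt x₀ fun e => ?_
  rw [mem_fractional, hx₀]
  intro hmem
  refine mem_fractional.1 (hy e) ?_
  have h1 : (y + castCycle Z).1 e = y.1 e + (Z.1 e : ℚ) := rfl
  rw [h1] at hmem
  have h2 : (Z.1 e : ℚ) ∈ (Int.castRingHom ℚ).range := ⟨Z.1 e, rfl⟩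
  exact (add_mem_cancel_right h2).1 hmem

/-- An emm has only finitely many minimal vectors: they are determined up to sign by their
classes modulo `2`. -/
lemma IsEmm.finite_minimal {q : QuadraticForm ℚ (o.H1 ℚ)} (hq : o.IsEmm q) :
    {v : o.H1 ℤ | q (o.coeffMap ℚ v) = 1}.Finite := by
  classical
  let b := Module.Free.chooseBasis ℤ (o.cycles ℤ)
  let π : o.H1 ℤ → (Module.Free.ChooseBasisIndex ℤ (o.cycles ℤ) → ZMod 2) :=
    fun v i => (pair (b i) v : ZMod 2)
  refine Set.Finite.of_finite_fibers π (Set.toFinite _) ?_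
  rintro _ ⟨v, hv, rfl⟩
  refine (Set.toFinite {v, -v}).subset ?_
  rintro v' ⟨hv', hπ⟩
  have hv1 : q (o.coeffMap ℚ v) = 1 := hv
  have hv1' : q (o.coeffMap ℚ v') = 1 := hv'
  have hdvd : ∀ x : o.cycles ℤ, (2 : ℤ) ∣ pair x (v - v') := by
    intro x
    rw [← b.sum_repr x, pair_sum]
    refine Finset.dvd_sum fun i _ => ?_
    rw [pair_smul]
    refine Dvd.dvd.mul_left ?_ _
    have h1 : (pair (b i) v' : ZMod 2) = (pair (b i) v : ZMod 2) := congrFun hπ i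
    rw [map_sub]
    exact (ZMod.intCast_eq_intCast_iff_dvd_sub _ _ 2).1 h1
  obtain ⟨u, hu⟩ := exists_smul_eq_of_dvd_pair 2 hdvd
  have hv'eq : v' = v - u - u := by
    rw [sub_sub, ← two_smul ℤ u, ← hu, sub_sub_cancel]
  -- The parallelogram law for `v = (v - u) + u` and `v' = (v - u) - u`. Nonzero integral vectors
  -- have norm at least `1`, so `u` or `v - u` vanishes.
  have hpar : q (o.coeffMap ℚ u) + q (o.coeffMap ℚ (v - u)) = 1 := by
    have h1 := QuadraticMap.map_add q (o.coeffMap ℚ (v - u)) (o.coeffMap ℚ u)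
    have h2 := QuadraticMap.map_add q (o.coeffMap ℚ (v - u)) (-o.coeffMap ℚ u)
    rw [QuadraticMap.polar_neg_right, QuadraticMap.map_neg, ← sub_eq_add_neg, ← map_sub,
      ← hv'eq, hv1'] at h2
    rw [← map_add, sub_add_cancel, hv1] at h1
    linarith
  by_cases hu0 : u = 0
  · left
    rw [hv'eq, hu0, sub_zero, sub_zero]
  · by_cases hvu : v - u = 0
    · right
      rw [Set.mem_singleton_iff, hv'eq, hvu, zero_sub, sub_eq_zero.1 hvu]
    · have := hq.one_le u hu0
      have := hq.one_le _ hvu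
      linarith

omit [Fintype G.edgeSet] [Finite G.vertexSet] in
lemma IsEmm.midpoint {q r : QuadraticForm ℚ (o.H1 ℚ)} (hq : o.IsEmm q) (hr : o.IsEmm r) :
    o.IsEmm ((1 / 2 : ℚ) • (q + r)) where
  posDef v hv := by
    have := hq.posDef v hv
    have := hr.posDef v hv
    rw [smul_apply, add_apply, smul_eq_mul]
    linarith
  coedge_eq e he := by
    rw [smul_apply, add_apply, hq.coedge_eq e he, hr.coedge_eq e he, smul_eq_mul]
    norm_num
  one_le v hv := by
    have := hq.one_le v hv
    have := hr.one_le v hv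
    rw [smul_apply, add_apply, smul_eq_mul]
    linarith

/-- Every vector of norm `1` in an emm, other than the coedges and their negatives, is longer than
`1` in another emm. -/
lemma IsEmm.exists_isEmm_one_lt {q : QuadraticForm ℚ (o.H1 ℚ)} (hq : o.IsEmm q)
    (hb : G.Bridgeless) {w : o.H1 ℤ} (hw : q (o.coeffMap ℚ w) = 1)
    (hne : ¬ ∃ e : G.edgeSet, w = o.coedge e ∨ w = -o.coedge e) :
    ∃ r : QuadraticForm ℚ (o.H1 ℚ), o.IsEmm r ∧ 1 < r (o.coeffMap ℚ w) := by
  have hw0 : w ≠ 0 := by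
    rintro rfl
    rw [map_zero, QuadraticMap.map_zero] at hw
    exact zero_ne_one hw
  refine Orientation.exists_isEmm_one_lt ?_ ?_
  · obtain ⟨c, hc, u, x, rfl, hx⟩ := exists_eq_smul_of_ne_zero hw0
    have hu : u ≠ 0 := by
      rintro rfl
      exact hw0 (smul_zero c)
    have h1 := hq.one_le u hu
    rw [map_smul, ← Int.cast_smul_eq_zsmul ℚ, QuadraticMap.map_smul, smul_eq_mul] at hw
    have hc1 : (1 : ℚ) ≤ c := by exact_mod_cast hc
    have hc2 : (c : ℚ) ≤ 1 := by nlinarith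
    obtain rfl : c = 1 := le_antisymm (by exact_mod_cast hc2) hc
    exact ⟨x, by rw [one_smul, hx]⟩
  · intro e c hc
    have h1 := hq.coedge_eq e (hb e.1 e.2)
    rw [hc, QuadraticMap.map_smul, hw, smul_eq_mul, mul_one] at h1
    refine hne ⟨e, ?_⟩
    rcases mul_self_eq_one_iff.1 h1 with rfl | rfl
    · left
      apply coeffMap_injective
      rw [hc, one_smul]
    · right
      apply coeffMap_injective
      rw [map_neg, hc, neg_one_smul, neg_neg]

/-- Every finite bridgeless graph has a strong emm; it need be neither connected nor cubic. -/
lemma exists_isStrongEmm (hb : G.Bridgeless) :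
    ∃ q : QuadraticForm ℚ (o.H1 ℚ), o.IsStrongEmm q := by
  let bad : QuadraticForm ℚ (o.H1 ℚ) → Set (o.H1 ℤ) := fun q =>
    {v | q (o.coeffMap ℚ v) = 1 ∧ ¬ ∃ e : G.edgeSet, v = o.coedge e ∨ v = -o.coedge e}
  have hfin : ∀ q, o.IsEmm q → (bad q).Finite := fun q hq =>
    hq.finite_minimal.subset fun v hv => hv.1
  suffices H : ∀ (k : ℕ) (q : QuadraticForm ℚ (o.H1 ℚ)), o.IsEmm q → (bad q).ncard = k →
      ∃ q : QuadraticForm ℚ (o.H1 ℚ), o.IsStrongEmm q by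
    obtain ⟨q, hq⟩ := exists_isEmm (o := o)
    exact H _ q hq rfl
  intro k
  induction k using Nat.strong_induction_on with
  | _ k ih =>
  intro q hq hk
  by_cases h : ∃ w, w ∈ bad q
  · obtain ⟨w, hw⟩ := h
    obtain ⟨r, hr, hlt⟩ := hq.exists_isEmm_one_lt hb hw.1 hw.2
    -- The midpoint has norm `1` only where both `q` and `r` do, so `w` leaves the bad set and
    -- nothing enters.
    have hmid := hq.midpoint hr
    refine ih _ ?_ _ hmid rfl
    rw [← hk]
    refine Set.ncard_lt_ncard ?_ (hfin q hq)
    rw [Set.ssubset_iff_of_subset]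
    · refine ⟨w, hw, fun hw' => ?_⟩
      have h1 := hw'.1
      rw [smul_apply, add_apply, smul_eq_mul, hw.1] at h1
      linarith
    · intro v hv
      refine ⟨?_, hv.2⟩
      have h1 := hv.1
      have hv0 : v ≠ 0 := by
        rintro rfl
        rw [map_zero, QuadraticMap.map_zero] at h1
        exact zero_ne_one h1
      have h2 := hq.one_le v hv0
      have h3 := hr.one_le v hv0
      rw [smul_apply, add_apply, smul_eq_mul] at h1
      linarith
  · refine ⟨q, { hq with eq_coedge := fun v hv => ?_ }⟩
    by_contra hn
    exact h ⟨v, hv, hn⟩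

end Strong

end Graph.Orientation

theorem mainTheorem2 {α : Type*} {β : Type*} (G : Graph α β)
    (hV : G.vertexSet.Finite) (hE : G.edgeSet.Finite)
    (hconn : G.Connected) (hcubic : G.Cubic) (hbridgeless : G.Bridgeless)
    (o : G.Orientation) :
    ∃ q : QuadraticForm ℚ (o.H1 ℚ), o.IsStrongEmm q := by
  have := hE.fintype
  have := hV.to_subtype
  exact Graph.Orientation.exists_isStrongEmm hbridgeless
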